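/- Let $F$ be a field of characteristic zero. Let $M_{1,2}(F)$ be the algebra of $3\times 3$ matrices over $F$ with the $\mathbb{Z}_2$-grading in which the even matrices are the block diagonal ones and the odd matrices the block off-diagonal ones, for blocks of sizes $1,2$, and with the orthosymplectic superinvolution $$\begin{pmatrix} a&b&c\\ d&e&f\\ g&h&i\end{pmatrix}^{*}=\begin{pmatrix} a&-g&d\\ c&i&-f\\ -b&-h&e\end{pmatrix}.$$ Let $F\langle Y\cup Z,*\rangle$ be the free superalgebra with superinvolution, that is, the free associative algebra on the variables $y_i^+,y_i^-,z_i^+,z_i^-$ ($y$ even, $z$ odd, $+$ symmetric, $-$ skew) with the induced grading and the superinvolution with $(ab)^*=(-1)^{|a||b|}b^*a^*$ for homogeneous $a,b$. A $*$-identity of $M_{1,2}(F)$ is an element of $F\langle Y\cup Z,*\rangle$ that vanishes whenever each variable is replaced by a matrix of the same parity that is symmetric, respectively skew, under $*$. A $T_2^*$-ideal is a two-sided ideal of $F\langle Y\cup Z,*\rangle$ invariant under all graded algebra endomorphisms commuting with $*$. Put $y=\tfrac12(y_2^++y_2^-)$ (a generic even variable), and let $\mathcal I$ be the set of the ten $*$-polynomials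 $$[y_1^+,y],\quad y_1^-z_1^+y_2^-,\quad y_1^-z_1^-y_2^-,$$ $$z_1^+z_2^+z_3^++z_2^+z_3^+z_1^++z_3^+z_1^+z_2^+,\quad z_1^-z_2^-z_3^-+z_2^-z_3^-z_1^-+z_3^-z_1^-z_2^-,$$ $$z_1^+y_1^-z_2^+-z_2^+y_1^-z_1^+,\quad z_1^-y_1^-z_2^--z_2^-y_1^-z_1^-,$$ $$z_1^+z_2^+z_1^--z_2^+z_1^-z_1^++z_1^-z_1^+z_2^+,\quad z_1^-z_2^-z_1^+-z_2^-z_1^+z_1^-+z_1^+z_1^-z_2^-,\quad z_1^+y_1^-z_1^-+z_1^-y_1^-z_1^+ .$$ Then every element of $\mathcal I$ is a $*$-identity of $M_{1,2}(F)$, and every $*$-identity of $M_{1,2}(F)$ of degree at most $3$ lies in the $T_2^*$-ideal generated by $\mathcal I$. Moreover $M_{1,2}(F)$ has no nonzero $*$-identity of degree at most $1$. -/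

import Mathlib

namespace StarPI

universe u v

/-! ### Superalgebras with superinvolution -/

/-- A superinvolution on an associative unital `F`-algebra `A`: a decomposition
`A = A₀ ⊕ A₁` with `Aᵢ Aⱼ ⊆ Aᵢ₊ⱼ`, and a linear map `star` preserving it, with `(a^*)^* = a` and
`(a b)^* = (-1)^(|a| |b|) b^* a^*` for homogeneous `a`, `b`. -/
structure StarSuperalgebra (F : Type u) (A : Type v) [Field F] [Ring A] [Algebra F A] where
  /-- the homogeneous components `A₀` and `A₁` -/
  comp : ZMod 2 → Submodule F A
  isCompl : IsCompl (comp 0) (comp 1)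
  mul_mem : ∀ (i j : ZMod 2) (a b : A), a ∈ comp i → b ∈ comp j → a * b ∈ comp (i + j)
  /-- the superinvolution -/
  star : A →ₗ[F] A
  star_mem : ∀ (i : ZMod 2) (a : A), a ∈ comp i → star a ∈ comp i
  star_star : ∀ a : A, star (star a) = a
  star_mul : ∀ (i j : ZMod 2) (a b : A), a ∈ comp i → b ∈ comp j →
    star (a * b) = (-1 : F) ^ (i.val * j.val) • (star b * star a)

/-! ### The free superalgebra with superinvolution -/

/-- The variables `yᵢ⁺`, `yᵢ⁻`, `zᵢ⁺`, `zᵢ⁻`. -/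
inductive StarVar : Type
  | yPlus (i : ℕ)
  | yMinus (i : ℕ)
  | zPlus (i : ℕ)
  | zMinus (i : ℕ)

/-- The homogeneous degree of a variable: `0` for `y`, `1` for `z`. -/
def StarVar.parity : StarVar → ZMod 2
  | .yPlus _ => 0
  | .yMinus _ => 0
  | .zPlus _ => 1
  | .zMinus _ => 1

/-- `1` for symmetric variables, `-1` for skew variables. -/
def StarVar.sign : StarVar → ℤ
  | .yPlus _ => 1
  | .yMinus _ => -1
  | .zPlus _ => 1
  | .zMinus _ => -1

/-- The free algebra `F⟨Y ∪ Z, *⟩` on the variables `yᵢ⁺`, `yᵢ⁻`, `zᵢ⁺`, `zᵢ⁻`. -/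
abbrev FreeStar (F : Type u) [Field F] : Type u := FreeAlgebra F StarVar

/-- The homogeneous degree of a word. -/
def wordParity (w : List StarVar) : ZMod 2 := (w.map StarVar.parity).sum

/-- The number of variables of odd degree in a word. -/
def oddCount (w : List StarVar) : ℕ := (w.map fun x => x.parity.val).sum

/-- The product of the signs of the variables in a word. -/
def wordSign (w : List StarVar) : ℤ := (w.map StarVar.sign).prod

section Free

variable (F : Type u) [Field F]

/-- The monomial of `F⟨Y ∪ Z, *⟩` given by a word. -/
def monom (w : List StarVar) : FreeStar F := (w.map (FreeAlgebra.ι F)).prod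

/-- The homogeneous component of degree `i`: the span of the words of degree `i`. -/
def freeComp (i : ZMod 2) : Submodule F (FreeStar F) :=
  Submodule.span F (monom F '' {w | wordParity w = i})

/-- The `*`-polynomials of degree at most `n`: the span of the words of length at most `n`. -/
def degreeLE (n : ℕ) : Submodule F (FreeStar F) :=
  Submodule.span F (monom F '' {w | w.length ≤ n})

/-- The superinvolution of the free algebra. On words it is
`(x₁ ⋯ xₙ)^* = (-1)^(k (k - 1) / 2) xₙ^* ⋯ x₁^*`, where `k` is the number of variables of odd
degree among the `xᵢ`, and `x^* = ± x` for a symmetric, respectively skew, variable `x`. -/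
noncomputable def freeStarMap : FreeStar F →ₗ[F] FreeStar F :=
  (FreeAlgebra.basisFreeMonoid F StarVar).constr F fun w =>
    ((-1 : F) ^ (oddCount w.toList).choose 2 * (wordSign w.toList : F)) • monom F w.toList.reverse

theorem basis_eq_monom (w : FreeMonoid StarVar) :
    FreeAlgebra.basisFreeMonoid F StarVar w = monom F w.toList := by
  simp [FreeAlgebra.basisFreeMonoid, FreeAlgebra.equivMonoidAlgebraFreeMonoid, monom,
    FreeMonoid.lift_apply]

theorem linearIndependent_monom : LinearIndependent F (monom F) := by
  have h := (FreeAlgebra.basisFreeMonoid F StarVar).linearIndependent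
  have e : (FreeAlgebra.basisFreeMonoid F StarVar : FreeMonoid StarVar → FreeStar F)
      = monom F ∘ FreeMonoid.toList := by
    funext w
    exact basis_eq_monom F w
  rw [e] at h
  exact (linearIndependent_equiv FreeMonoid.toList).1 h

theorem span_monom : Submodule.span F (Set.range (monom F)) = ⊤ := by
  rw [← (FreeAlgebra.basisFreeMonoid F StarVar).span_eq]
  congr 1
  ext x
  constructor
  · rintro ⟨w, rfl⟩
    exact ⟨FreeMonoid.ofList w, basis_eq_monom F _⟩
  · rintro ⟨w, rfl⟩
    exact ⟨w.toList, (basis_eq_monom F w).symm⟩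

theorem freeStarMap_monom (w : List StarVar) :
    freeStarMap F (monom F w) =
      ((-1 : F) ^ (oddCount w).choose 2 * (wordSign w : F)) • monom F w.reverse := by
  have h := (FreeAlgebra.basisFreeMonoid F StarVar).constr_basis F
    (fun w : FreeMonoid StarVar => ((-1 : F) ^ (oddCount w.toList).choose 2 *
      (wordSign w.toList : F)) • monom F w.toList.reverse) (FreeMonoid.ofList w)
  rw [basis_eq_monom] at h
  exact h

theorem monom_append (v w : List StarVar) : monom F (v ++ w) = monom F v * monom F w := by
  simp [monom]

end Free

theorem wordParity_append (v w : List StarVar) :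
    wordParity (v ++ w) = wordParity v + wordParity w := by
  simp [wordParity]

theorem wordParity_reverse (w : List StarVar) : wordParity w.reverse = wordParity w := by
  simp [wordParity, List.sum_reverse]

theorem oddCount_append (v w : List StarVar) :
    oddCount (v ++ w) = oddCount v + oddCount w := by
  simp [oddCount]

theorem oddCount_reverse (w : List StarVar) : oddCount w.reverse = oddCount w := by
  simp [oddCount, List.sum_reverse]

theorem wordSign_append (v w : List StarVar) :
    wordSign (v ++ w) = wordSign v * wordSign w := by
  simp [wordSign]

theorem wordSign_reverse (w : List StarVar) : wordSign w.reverse = wordSign w := by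
  simp [wordSign, List.prod_reverse]

theorem wordSign_mul_self (w : List StarVar) : wordSign w * wordSign w = 1 := by
  induction w with
  | nil => simp [wordSign]
  | cons x w ih =>
    have hx : x.sign * x.sign = 1 := by cases x <;> simp [StarVar.sign]
    have : wordSign (x :: w) = x.sign * wordSign w := by simp [wordSign]
    rw [this, mul_mul_mul_comm, hx, ih, one_mul]

theorem oddCount_cast (w : List StarVar) : (oddCount w : ZMod 2) = wordParity w := by
  induction w with
  | nil => simp [oddCount, wordParity]
  | cons x w ih =>
    have h1 : oddCount (x :: w) = x.parity.val + oddCount w := by simp [oddCount]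
    have h2 : wordParity (x :: w) = x.parity + wordParity w := by simp [wordParity]
    rw [h1, h2, Nat.cast_add, ih, ZMod.natCast_zmod_val]

theorem oddCount_mod (w : List StarVar) : oddCount w % 2 = (wordParity w).val := by
  rw [← oddCount_cast, ZMod.val_natCast]

theorem choose_two_add (k l : ℕ) :
    (k + l).choose 2 = k.choose 2 + l.choose 2 + k * l := by
  induction l with
  | zero => simp
  | succ l ih =>
    rw [← add_assoc, Nat.choose_succ_succ' (k + l) 1, ih, Nat.choose_succ_succ' l 1,
      Nat.choose_one_right, Nat.choose_one_right]
    ring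

theorem neg_one_pow_mul_mod (F : Type u) [Field F] (k l : ℕ) :
    (-1 : F) ^ (k * l) = (-1 : F) ^ ((k % 2) * (l % 2)) := by
  rw [pow_mul, neg_one_pow_eq_pow_mod_two (R := F) k, ← pow_mul, mul_comm, pow_mul,
    neg_one_pow_eq_pow_mod_two (R := F) l, ← pow_mul, mul_comm]

/-- The free superalgebra with superinvolution. -/
noncomputable def freeStarSuperalgebra (F : Type u) [Field F] :
    StarSuperalgebra F (FreeStar F) where
  comp := freeComp F
  isCompl := by
    constructor
    · refine (linearIndependent_monom F).disjoint_span_image ?_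
      rw [Set.disjoint_left]
      intro w h0 h1
      simp only [Set.mem_ofPred_eq] at h0 h1
      rw [h0] at h1
      exact absurd h1 (by decide)
    · rw [codisjoint_iff, freeComp, freeComp, ← Submodule.span_union, ← Set.image_union,
        ← span_monom F, ← Set.image_univ]
      congr 2
      ext w
      simp only [Set.mem_union, Set.mem_ofPred_eq, Set.mem_univ, iff_true]
      generalize wordParity w = p
      revert p
      decide
  mul_mem := by
    intro i j a b ha hb
    have h := Submodule.mul_mem_mul ha hb
    rw [freeComp, freeComp, Submodule.span_mul_span] at h
    refine Submodule.span_mono ?_ h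
    rintro _ ⟨_, ⟨v, hv, rfl⟩, _, ⟨w, hw, rfl⟩, rfl⟩
    refine ⟨v ++ w, ?_, monom_append F v w⟩
    simp only [Set.mem_ofPred_eq] at hv hw ⊢
    rw [wordParity_append, hv, hw]
  star := freeStarMap F
  star_mem := by
    intro i a ha
    induction ha using Submodule.span_induction with
    | mem x hx =>
      obtain ⟨w, hw, rfl⟩ := hx
      rw [freeStarMap_monom]
      refine Submodule.smul_mem _ _ (Submodule.subset_span ⟨w.reverse, ?_, rfl⟩)
      simp only [Set.mem_ofPred_eq] at hw ⊢
      rw [wordParity_reverse, hw]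
    | zero => simp
    | add x y _ _ hx hy => rw [map_add]; exact Submodule.add_mem _ hx hy
    | smul c x _ hx => rw [map_smul]; exact Submodule.smul_mem _ _ hx
  star_star := by
    intro a
    have ha : a ∈ Submodule.span F (Set.range (monom F)) := by rw [span_monom]; trivial
    induction ha using Submodule.span_induction with
    | mem x hx =>
      obtain ⟨w, rfl⟩ := hx
      rw [freeStarMap_monom, map_smul, freeStarMap_monom, smul_smul, List.reverse_reverse,
        oddCount_reverse, wordSign_reverse, mul_mul_mul_comm, ← mul_pow, ← Int.cast_mul,
        wordSign_mul_self]
      simp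
    | zero => simp
    | add x y _ _ hx hy => rw [map_add, map_add, hx, hy]
    | smul c x _ hx => rw [map_smul, map_smul, hx]
  star_mul := by
    intro i j a b ha hb
    induction ha using Submodule.span_induction with
    | mem x hx =>
      obtain ⟨v, hv, rfl⟩ := hx
      induction hb using Submodule.span_induction with
      | mem y hy =>
        obtain ⟨w, hw, rfl⟩ := hy
        simp only [Set.mem_ofPred_eq] at hv hw
        rw [← monom_append, freeStarMap_monom, freeStarMap_monom, freeStarMap_monom,
          smul_mul_smul_comm, smul_smul, ← monom_append, List.reverse_append, oddCount_append,
          wordSign_append, choose_two_add, pow_add, pow_add,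
          neg_one_pow_mul_mod F (oddCount v) (oddCount w), oddCount_mod, oddCount_mod, hv, hw,
          Int.cast_mul]
        congr 1
        ring
      | zero => simp
      | add x y _ _ hx hy => rw [mul_add, map_add, hx, hy, map_add, add_mul, smul_add]
      | smul c x _ hx => rw [mul_smul_comm, map_smul, hx, map_smul, smul_mul_assoc, smul_comm]
    | zero => simp
    | add x y _ _ hx hy => rw [add_mul, map_add, hx, hy, map_add, mul_add, smul_add]
    | smul c x _ hx => rw [smul_mul_assoc, map_smul, hx, map_smul, mul_smul_comm, smul_comm]

/-! ### `*`-identities, `T₂^*`-ideals and consequences -/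

section Identities

variable {F : Type u} [Field F] {A : Type v} [Ring A] [Algebra F A]

/-- `f` is a `*`-identity: it vanishes under every substitution of the variables by homogeneous
elements of the matching degree that are symmetric, respectively skew. -/
def IsStarIdentity (S : StarSuperalgebra F A) (f : FreeStar F) : Prop :=
  ∀ ρ : StarVar → A,
    (∀ x, ρ x ∈ S.comp x.parity ∧ S.star (ρ x) = (x.sign : F) • ρ x) →
      FreeAlgebra.lift F ρ f = 0

/-- A `T₂^*`-ideal of `F⟨Y ∪ Z, *⟩`: a two-sided ideal invariant under all graded endomorphisms
commuting with the superinvolution. -/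
def IsTIdeal (J : TwoSidedIdeal (FreeStar F)) : Prop :=
  ∀ φ : FreeStar F →ₐ[F] FreeStar F,
    (∀ i, ∀ a ∈ (freeStarSuperalgebra F).comp i, φ a ∈ (freeStarSuperalgebra F).comp i) →
    (∀ a, φ ((freeStarSuperalgebra F).star a) = (freeStarSuperalgebra F).star (φ a)) →
      ∀ f ∈ J, φ f ∈ J

/-- The `T₂^*`-ideal generated by a set of `*`-polynomials. -/
def tIdealSpan (G : Set (FreeStar F)) : TwoSidedIdeal (FreeStar F) :=
  sInf {J | IsTIdeal J ∧ ∀ g ∈ G, g ∈ J}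

theorem isTIdeal_tIdealSpan (G : Set (FreeStar F)) : IsTIdeal (tIdealSpan G) := by
  intro φ h1 h2 f hf
  rw [tIdealSpan, TwoSidedIdeal.mem_sInf] at hf ⊢
  exact fun J hJ => hJ.1 φ h1 h2 f (hf J hJ)

end Identities

/-! ### The algebra `M_{1,2}(F)` with the orthosymplectic superinvolution -/

/-- The orthosymplectic superinvolution of `M_{1,2}(F)`. -/
def osp (F : Type u) [Field F] : Matrix (Fin 3) (Fin 3) F →ₗ[F] Matrix (Fin 3) (Fin 3) F where
  toFun M :=
    !![M 0 0, -M 2 0, M 1 0;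
       M 0 2, M 2 2, -M 1 2;
       -M 0 1, -M 2 1, M 1 1]
  map_add' M N := by
    ext i j
    fin_cases i <;> fin_cases j <;> simp [add_comm]
  map_smul' c M := by
    ext i j
    fin_cases i <;> fin_cases j <;> simp

/-- The grading of the index set given by the block sizes `1`, `2`. -/
def idxParity : Fin 3 → ZMod 2 := ![0, 1, 1]

/-- The component of degree `k`: block diagonal matrices for `k = 0`, block off-diagonal matrices
for `k = 1`. -/
def matComp (F : Type u) [Field F] (k : ZMod 2) : Submodule F (Matrix (Fin 3) (Fin 3) F) where
  carrier := {M | ∀ i j, idxParity i + idxParity j ≠ k → M i j = 0}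
  add_mem' {M N} hM hN i j h := by simp [hM i j h, hN i j h]
  zero_mem' i j _ := rfl
  smul_mem' c M hM i j h := by simp [hM i j h]

theorem mem_matComp_zero {F : Type u} [Field F] {M : Matrix (Fin 3) (Fin 3) F} :
    M ∈ matComp F 0 ↔ M 0 1 = 0 ∧ M 0 2 = 0 ∧ M 1 0 = 0 ∧ M 2 0 = 0 := by
  have e : (1 : ZMod 2) + 1 = 0 := by decide
  constructor
  · intro h
    exact ⟨h 0 1 (by decide), h 0 2 (by decide), h 1 0 (by decide), h 2 0 (by decide)⟩
  · rintro ⟨h1, h2, h3, h4⟩ i j h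
    fin_cases i <;> fin_cases j <;> simp_all [idxParity]

theorem mem_matComp_one {F : Type u} [Field F] {M : Matrix (Fin 3) (Fin 3) F} :
    M ∈ matComp F 1 ↔ M 0 0 = 0 ∧ M 1 1 = 0 ∧ M 1 2 = 0 ∧ M 2 1 = 0 ∧ M 2 2 = 0 := by
  constructor
  · intro h
    exact ⟨h 0 0 (by decide), h 1 1 (by decide), h 1 2 (by decide), h 2 1 (by decide),
      h 2 2 (by decide)⟩
  · rintro ⟨h1, h2, h3, h4, h5⟩ i j h
    fin_cases i <;> fin_cases j <;> simp_all [idxParity]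

/-- `M_{1,2}(F)`: the `3 × 3` matrices with the grading by blocks of size `1`, `2` and the
orthosymplectic superinvolution. -/
def M12 (F : Type u) [Field F] : StarSuperalgebra F (Matrix (Fin 3) (Fin 3) F) where
  comp := matComp F
  isCompl := by
    constructor
    · rw [Submodule.disjoint_def]
      intro M h0 h1
      rw [mem_matComp_zero] at h0
      rw [mem_matComp_one] at h1
      ext i j
      fin_cases i <;> fin_cases j <;> simp_all
    · rw [codisjoint_iff, eq_top_iff]
      intro M _
      have e : M = !![M 0 0, 0, 0; 0, M 1 1, M 1 2; 0, M 2 1, M 2 2] +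
          !![0, M 0 1, M 0 2; M 1 0, 0, 0; M 2 0, 0, 0] := by
        ext i j
        fin_cases i <;> fin_cases j <;> simp
      rw [e]
      exact Submodule.add_mem_sup (mem_matComp_zero.2 (by simp)) (mem_matComp_one.2 (by simp))
  mul_mem := by
    intro p q M N hM hN i j h
    rw [Matrix.mul_apply]
    refine Finset.sum_eq_zero fun k _ => ?_
    by_cases h1 : idxParity i + idxParity k = p
    · by_cases h2 : idxParity k + idxParity j = q
      · refine absurd ?_ h
        rw [← h1, ← h2]
        generalize idxParity i = x
        generalize idxParity j = y
        generalize idxParity k = z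
        revert x y z
        decide
      · rw [hN k j h2, mul_zero]
    · rw [hM i k h1, zero_mul]
  star := osp F
  star_mem := by
    intro k M hM
    fin_cases k
    · have h := mem_matComp_zero.1 hM
      exact mem_matComp_zero.2 (by simp [osp, h])
    · have h := mem_matComp_one.1 hM
      exact mem_matComp_one.2 (by simp [osp, h])
  star_star := by
    intro M
    ext i j
    fin_cases i <;> fin_cases j <;> simp [osp]
  star_mul := by
    intro p q M N hM hN
    fin_cases p <;> fin_cases q
    · obtain ⟨a1, a2, a3, a4⟩ := mem_matComp_zero.1 hM
      obtain ⟨b1, b2, b3, b4⟩ := mem_matComp_zero.1 hN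
      change osp F (M * N) = (-1 : F) ^ (0 * 0) • (osp F N * osp F M)
      ext i j
      fin_cases i <;> fin_cases j <;>
        simp [osp, Matrix.mul_apply, Fin.sum_univ_three, a1, a2, a3, a4,
          b1, b2, b3, b4] <;> ring
    · obtain ⟨a1, a2, a3, a4⟩ := mem_matComp_zero.1 hM
      obtain ⟨b1, b2, b3, b4, b5⟩ := mem_matComp_one.1 hN
      change osp F (M * N) = (-1 : F) ^ (0 * 1) • (osp F N * osp F M)
      ext i j
      fin_cases i <;> fin_cases j <;>
        simp [osp, Matrix.mul_apply, Fin.sum_univ_three, a1, a2, a3, a4,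
          b1, b2, b3, b4, b5] <;> ring
    · obtain ⟨a1, a2, a3, a4, a5⟩ := mem_matComp_one.1 hM
      obtain ⟨b1, b2, b3, b4⟩ := mem_matComp_zero.1 hN
      change osp F (M * N) = (-1 : F) ^ (1 * 0) • (osp F N * osp F M)
      ext i j
      fin_cases i <;> fin_cases j <;>
        simp [osp, Matrix.mul_apply, Fin.sum_univ_three, a1, a2, a3, a4, a5,
          b1, b2, b3, b4] <;> ring
    · obtain ⟨a1, a2, a3, a4, a5⟩ := mem_matComp_one.1 hM
      obtain ⟨b1, b2, b3, b4, b5⟩ := mem_matComp_one.1 hN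
      change osp F (M * N) = (-1 : F) ^ (1 * 1) • (osp F N * osp F M)
      ext i j
      fin_cases i <;> fin_cases j <;>
        simp [osp, Matrix.mul_apply, Fin.sum_univ_three, a1, a2, a3, a4, a5,
          b1, b2, b3, b4, b5] <;> ring

/-! ### The ten generating identities -/

section Generators

variable (F : Type u) [Field F]

/-- The symmetric variable `yᵢ⁺` of even degree. -/
def yp (i : ℕ) : FreeStar F := FreeAlgebra.ι F (.yPlus i)

/-- The skew variable `yᵢ⁻` of even degree. -/
def ym (i : ℕ) : FreeStar F := FreeAlgebra.ι F (.yMinus i)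

/-- The symmetric variable `zᵢ⁺` of odd degree. -/
def zp (i : ℕ) : FreeStar F := FreeAlgebra.ι F (.zPlus i)

/-- The skew variable `zᵢ⁻` of odd degree. -/
def zm (i : ℕ) : FreeStar F := FreeAlgebra.ι F (.zMinus i)

/-- The variable `yᵢ` of even degree, where `yᵢ⁺ = yᵢ + yᵢ^*` and `yᵢ⁻ = yᵢ - yᵢ^*`. -/
def yv (i : ℕ) : FreeStar F := (2 : F)⁻¹ • (yp F i + ym F i)

/-- The set `𝓘` of ten `*`-polynomials. -/
def generators : Set (FreeStar F) :=
  {yp F 1 * yv F 2 - yv F 2 * yp F 1,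
   ym F 1 * zp F 1 * ym F 2,
   ym F 1 * zm F 1 * ym F 2,
   zp F 1 * zp F 2 * zp F 3 + zp F 2 * zp F 3 * zp F 1 + zp F 3 * zp F 1 * zp F 2,
   zm F 1 * zm F 2 * zm F 3 + zm F 2 * zm F 3 * zm F 1 + zm F 3 * zm F 1 * zm F 2,
   zp F 1 * ym F 1 * zp F 2 - zp F 2 * ym F 1 * zp F 1,
   zm F 1 * ym F 1 * zm F 2 - zm F 2 * ym F 1 * zm F 1,
   zp F 1 * zp F 2 * zm F 1 - zp F 2 * zm F 1 * zp F 1 + zm F 1 * zp F 1 * zp F 2,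
   zm F 1 * zm F 2 * zp F 1 - zm F 2 * zp F 1 * zm F 1 + zp F 1 * zm F 1 * zm F 2,
   zp F 1 * ym F 1 * zm F 1 + zm F 1 * ym F 1 * zp F 1}

end Generators

end StarPI

/-! The even part of $M_{1,2}(F)$ is $F\oplus M_2(F)$: its symmetric elements form the centre and
its skew elements are the trace-zero matrices of the $M_2$ block. An odd matrix of given sign is
determined by its first row, a vector in $F^2$. With these parametrizations the ten identities are
checked entry by entry.

The converse is proved in the quotient `RelFree` by the $T_2^*$-ideal. Any substitution of the
variables by homogeneous elements of matching parity and sign extends to a graded endomorphism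
commuting with $*$, so each generator becomes a relation among the images of all such elements
(`comm_of_even`, `skew_odd_skew`, `odd_skew_odd`, `odd_odd_odd`).

A multilinear polynomial of degree three has six coefficients. For each choice of kinds of its
variables, a few substitutions by matrices give linear equations on these coefficients, and every
solution is a combination of the relations above. Up to permuting the variables there are eight
cases, the lemmas `complete_*_*_*`; `multilinearComplete` collects them.

A general identity of degree at most three is reduced to this by polarization in characteristic
zero: its cubic part is, up to the factor 6, a sum of multilinear identities. The quadratic part
becomes cubic by adding a third variable, later replaced by 1, and the affine part is zero. -/

namespace StarPI

/-! ### Homogeneous elements of given parity and sign. -/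

section Homogeneous

variable {F : Type*} [Field F] {A : Type*} [Ring A] [Algebra F A]

/-- `a` is homogeneous of degree `p` and satisfies `a^* = s a`. -/
def Homog (S : StarSuperalgebra F A) (p : ZMod 2) (s : F) (a : A) : Prop :=
  a ∈ S.comp p ∧ S.star a = s • a

variable {S : StarSuperalgebra F A} {p : ZMod 2} {s : F} {a b : A}

theorem Homog.zero : Homog S p s 0 := ⟨Submodule.zero_mem _, by simp⟩

theorem Homog.add (ha : Homog S p s a) (hb : Homog S p s b) : Homog S p s (a + b) :=
  ⟨Submodule.add_mem _ ha.1 hb.1, by rw [map_add, ha.2, hb.2, smul_add]⟩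

end Homogeneous

/-! ### Substitutions in the free algebra and the relations they impose on the quotient. -/

section Free

variable {F : Type*} [Field F]

theorem monom_mem_freeComp (w : List StarVar) : monom F w ∈ freeComp F (wordParity w) :=
  Submodule.subset_span ⟨w, rfl, rfl⟩

theorem monom_cons (x : StarVar) (w : List StarVar) :
    monom F (x :: w) = FreeAlgebra.ι F x * monom F w := by
  simp [monom]

theorem monom_nil : monom F [] = 1 := by
  simp [monom]

theorem homog_one : Homog (freeStarSuperalgebra F) 0 1 1 := by
  rw [← monom_nil]
  refine ⟨monom_mem_freeComp [], ?_⟩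
  change freeStarMap F _ = _
  rw [freeStarMap_monom]
  simp [oddCount, wordSign]

theorem homog_ι (x : StarVar) :
    Homog (freeStarSuperalgebra F) x.parity (x.sign : F) (FreeAlgebra.ι F x) := by
  have h : FreeAlgebra.ι F x = monom F [x] := by simp [monom]
  rw [h]
  constructor
  · change monom F [x] ∈ freeComp F x.parity
    simpa [wordParity] using monom_mem_freeComp (F := F) [x]
  · change freeStarMap F _ = _
    rw [freeStarMap_monom]
    cases x <;> simp [oddCount, wordSign, StarVar.parity, StarVar.sign, show (1 : ZMod 2).val = 1 from rfl]

theorem lift_mem_freeComp {ρ : StarVar → FreeStar F}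
    (hρ : ∀ x, Homog (freeStarSuperalgebra F) x.parity (x.sign : F) (ρ x)) (i : ZMod 2)
    {a : FreeStar F} (ha : a ∈ freeComp F i) : FreeAlgebra.lift F ρ a ∈ freeComp F i := by
  induction ha using Submodule.span_induction with
  | mem x hx =>
    obtain ⟨w, hw, rfl⟩ := hx
    simp only [Set.mem_ofPred_eq] at hw
    subst hw
    induction w with
    | nil => rw [monom_nil, map_one]; exact homog_one.1
    | cons x w ih =>
      rw [monom_cons, map_mul, FreeAlgebra.lift_ι_apply]
      have h := (freeStarSuperalgebra F).mul_mem _ _ _ _ (hρ x).1 ih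
      rw [wordParity, List.map_cons, List.sum_cons]
      exact h
  | zero => simp
  | add x y _ _ hx hy => rw [map_add]; exact Submodule.add_mem _ hx hy
  | smul c x _ hx => rw [map_smul]; exact Submodule.smul_mem _ _ hx

/-- By induction on words: the sign in `star_mul` depends only on parities, which the substitution
preserves, so the two sides pick up the same factor at each letter. -/
theorem lift_star {ρ : StarVar → FreeStar F}
    (hρ : ∀ x, Homog (freeStarSuperalgebra F) x.parity (x.sign : F) (ρ x)) (a : FreeStar F) :
    FreeAlgebra.lift F ρ ((freeStarSuperalgebra F).star a) =
      (freeStarSuperalgebra F).star (FreeAlgebra.lift F ρ a) := by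
  have ha : a ∈ Submodule.span F (Set.range (monom F)) := by rw [span_monom]; trivial
  induction ha using Submodule.span_induction with
  | mem x hx =>
    obtain ⟨w, rfl⟩ := hx
    induction w with
    | nil => rw [monom_nil, homog_one.2, one_smul, map_one, homog_one.2, one_smul]
    | cons x w ih =>
      rw [monom_cons, map_mul (FreeAlgebra.lift F ρ),
        (freeStarSuperalgebra F).star_mul _ _ _ _ (homog_ι x).1 (monom_mem_freeComp w),
        FreeAlgebra.lift_ι_apply, (freeStarSuperalgebra F).star_mul _ _ _ _ (hρ x).1
        (lift_mem_freeComp hρ _ (monom_mem_freeComp w)), map_smul, map_mul, ih, (homog_ι x).2,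
        map_smul, FreeAlgebra.lift_ι_apply, (hρ x).2]
  | zero => simp
  | add x y _ _ hx hy => simp only [map_add, hx, hy]
  | smul c x _ hx => simp only [map_smul, hx]

theorem lift_mem_tIdealSpan {G : Set (FreeStar F)} {ρ : StarVar → FreeStar F}
    (hρ : ∀ x, Homog (freeStarSuperalgebra F) x.parity (x.sign : F) (ρ x)) {f : FreeStar F}
    (hf : f ∈ G) : FreeAlgebra.lift F ρ f ∈ tIdealSpan G := by
  refine isTIdeal_tIdealSpan G _ (fun i a ha => lift_mem_freeComp hρ i ha) (lift_star hρ) f ?_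
  rw [tIdealSpan, TwoSidedIdeal.mem_sInf]
  exact fun J hJ => hJ.2 f hf

variable (F) in
/-- The quotient of the free algebra by the `T₂^*`-ideal generated by `𝓘`. -/
abbrev RelFree : Type _ := (tIdealSpan (generators F)).ringCon.Quotient

variable (F) in
/-- The quotient map to `RelFree F`. -/
def toRelFree : FreeStar F →ₐ[F] RelFree F :=
  { (tIdealSpan (generators F)).ringCon.mk' with
    commutes' := fun _ => rfl }

theorem toRelFree_eq_zero {f : FreeStar F} :
    toRelFree F f = 0 ↔ f ∈ tIdealSpan (generators F) := by
  rw [TwoSidedIdeal.mem_iff, ← RingCon.eq]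
  rfl

/-- The sequence with values `a`, `b` at `1`, `2` and `c` elsewhere. -/
def triple {X : Type*} (a b c : X) : ℕ → X
  | 1 => a
  | 2 => b
  | _ => c

/-- The substitution of the variables of the four kinds by four sequences. -/
def assign (a b c d : ℕ → FreeStar F) : StarVar → FreeStar F
  | .yPlus i => a i
  | .yMinus i => b i
  | .zPlus i => c i
  | .zMinus i => d i

theorem homog_assign {a b c d : ℕ → FreeStar F}
    (ha : ∀ i, Homog (freeStarSuperalgebra F) 0 1 (a i))
    (hb : ∀ i, Homog (freeStarSuperalgebra F) 0 (-1) (b i))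
    (hc : ∀ i, Homog (freeStarSuperalgebra F) 1 1 (c i))
    (hd : ∀ i, Homog (freeStarSuperalgebra F) 1 (-1) (d i)) (x : StarVar) :
    Homog (freeStarSuperalgebra F) x.parity (x.sign : F) (assign a b c d x) := by
  cases x with
  | yPlus i => simpa [StarVar.sign, StarVar.parity, assign, triple] using ha _
  | yMinus i => simpa [StarVar.sign, StarVar.parity, assign, triple] using hb _
  | zPlus i => simpa [StarVar.sign, StarVar.parity, assign, triple] using hc _
  | zMinus i => simpa [StarVar.sign, StarVar.parity, assign, triple] using hd _

theorem toRelFree_assign {a b c d : ℕ → FreeStar F}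
    (ha : ∀ i, Homog (freeStarSuperalgebra F) 0 1 (a i))
    (hb : ∀ i, Homog (freeStarSuperalgebra F) 0 (-1) (b i))
    (hc : ∀ i, Homog (freeStarSuperalgebra F) 1 1 (c i))
    (hd : ∀ i, Homog (freeStarSuperalgebra F) 1 (-1) (d i)) {g : FreeStar F}
    (hg : g ∈ generators F) :
    toRelFree F (FreeAlgebra.lift F (assign a b c d) g) = 0 :=
  toRelFree_eq_zero.2 (lift_mem_tIdealSpan (homog_assign ha hb hc hd) hg)

theorem homog_zero_family {p : ZMod 2} {s : F} (i : ℕ) :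
    Homog (freeStarSuperalgebra F) p s ((0 : ℕ → FreeStar F) i) := Homog.zero

theorem homog_family {p : ZMod 2} {s : F} {a b c : FreeStar F}
    (ha : Homog (freeStarSuperalgebra F) p s a) (hb : Homog (freeStarSuperalgebra F) p s b)
    (hc : Homog (freeStarSuperalgebra F) p s c) (i : ℕ) :
    Homog (freeStarSuperalgebra F) p s (triple a b c i) := by
  unfold triple
  split
  · exact ha
  · exact hb
  · exact hc

variable {a b c u v : FreeStar F} {r s t : F}

local notation "π" => toRelFree F
local notation "Hom" => Homog (freeStarSuperalgebra F)

/-- The generator contains $\tfrac12(y_2^++y_2^-)$; substituting $v+v^*$ and $v-v^*$ turns it into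
$v$ itself. So $v$ may be any even element, for instance a product of two odd ones, whether or not
it is symmetric or skew. -/
theorem comm_of_even [CharZero F] (hu : Hom 0 1 u) (hv : v ∈ (freeStarSuperalgebra F).comp 0) :
    π u * π v = π v * π u := by
  have hv' := (freeStarSuperalgebra F).star_mem 0 v hv
  have h1 : Hom 0 1 (v + (freeStarSuperalgebra F).star v) :=
    ⟨Submodule.add_mem _ hv hv', by
      rw [map_add, (freeStarSuperalgebra F).star_star, one_smul, add_comm]⟩
  have h2 : Hom 0 (-1) (v - (freeStarSuperalgebra F).star v) :=
    ⟨Submodule.sub_mem _ hv hv', by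
      rw [map_sub, (freeStarSuperalgebra F).star_star, neg_one_smul, neg_sub]⟩
  have h := toRelFree_assign (homog_family hu h1 Homog.zero)
    (homog_family Homog.zero h2 Homog.zero) homog_zero_family homog_zero_family
    (show yp F 1 * yv F 2 - yv F 2 * yp F 1 ∈ generators F by simp [generators])
  have e : FreeAlgebra.lift F (assign
      (triple u (v + (freeStarSuperalgebra F).star v) 0)
      (triple 0 (v - (freeStarSuperalgebra F).star v) 0) 0 0) (yv F 2) = v := by
    simp only [yv, yp, ym, map_smul, map_add, FreeAlgebra.lift_ι_apply, assign, triple]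
    rw [add_add_sub_cancel, ← two_smul F v, smul_smul, inv_mul_cancel₀ two_ne_zero, one_smul]
  rw [map_sub, map_mul, map_mul, e, map_sub, map_mul, map_mul] at h
  simpa [yp, assign, triple, sub_eq_zero] using h

theorem skew_odd_skew (ha : Hom 0 (-1) a) (hb : Hom 1 s b) (hs : s = 1 ∨ s = -1)
    (hc : Hom 0 (-1) c) : π a * π b * π c = 0 := by
  rcases hs with rfl | rfl
  · have h := toRelFree_assign homog_zero_family (homog_family ha hc hc) (homog_family hb hb hb)
      homog_zero_family
      (show ym F 1 * zp F 1 * ym F 2 ∈ generators F by simp [generators])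
    simpa [yp, ym, zp, zm, assign, triple] using h
  · have h := toRelFree_assign homog_zero_family (homog_family ha hc hc) homog_zero_family
      (homog_family hb hb hb)
      (show ym F 1 * zm F 1 * ym F 2 ∈ generators F by simp [generators])
    simpa [yp, ym, zp, zm, assign, triple] using h

/-- One formula with signs for the three generators of shape odd, skew, odd. -/
theorem odd_skew_odd (ha : Hom 1 r a) (hr : r = 1 ∨ r = -1) (hb : Hom 0 (-1) b)
    (hc : Hom 1 t c) (ht : t = 1 ∨ t = -1) :
    π a * π b * π c = (r * t) • (π c * π b * π a) := by
  have mixed {a c : FreeStar F} (ha : Hom 1 1 a) (hc : Hom 1 (-1) c) :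
      π a * π b * π c + π c * π b * π a = 0 := by
    have h := toRelFree_assign homog_zero_family (homog_family hb hb hb) (homog_family ha ha ha)
      (homog_family hc hc hc)
      (show zp F 1 * ym F 1 * zm F 1 + zm F 1 * ym F 1 * zp F 1 ∈ generators F by
        simp [generators])
    simpa [yp, ym, zp, zm, assign, triple] using h
  rcases hr with rfl | rfl <;> rcases ht with rfl | rfl
  · have h := toRelFree_assign homog_zero_family (homog_family hb hb hb) (homog_family ha hc hc)
      homog_zero_family
      (show zp F 1 * ym F 1 * zp F 2 - zp F 2 * ym F 1 * zp F 1 ∈ generators F by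
        simp [generators])
    simpa [yp, ym, zp, zm, assign, triple, sub_eq_zero] using h
  · simpa using eq_neg_of_add_eq_zero_left (mixed ha hc)
  · simpa using eq_neg_of_add_eq_zero_right (mixed hc ha)
  · have h := toRelFree_assign homog_zero_family (homog_family hb hb hb) homog_zero_family
      (homog_family ha hc hc)
      (show zm F 1 * ym F 1 * zm F 2 - zm F 2 * ym F 1 * zm F 1 ∈ generators F by
        simp [generators])
    simpa [yp, ym, zp, zm, assign, triple, sub_eq_zero] using h

/-- One formula with signs for the four generators in three odd variables, so that the eight sign
patterns need not be separated later. -/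
theorem odd_odd_odd (ha : Hom 1 r a) (hr : r = 1 ∨ r = -1) (hb : Hom 1 s b)
    (hs : s = 1 ∨ s = -1) (hc : Hom 1 t c) (ht : t = 1 ∨ t = -1) :
    π a * π b * π c + (s * t) • (π b * π c * π a) + (r * s) • (π c * π a * π b) = 0 := by
  have plus {a b c : FreeStar F} (ha : Hom 1 1 a) (hb : Hom 1 1 b) (hc : Hom 1 (-1) c) :
      π a * π b * π c - π b * π c * π a + π c * π a * π b = 0 := by
    have h := toRelFree_assign homog_zero_family homog_zero_family (homog_family ha hb hb)
      (homog_family hc hc hc)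
      (show zp F 1 * zp F 2 * zm F 1 - zp F 2 * zm F 1 * zp F 1 + zm F 1 * zp F 1 * zp F 2 ∈
        generators F by simp [generators])
    simpa [yp, ym, zp, zm, assign, triple] using h
  have minus {a b c : FreeStar F} (ha : Hom 1 (-1) a) (hb : Hom 1 (-1) b) (hc : Hom 1 1 c) :
      π a * π b * π c - π b * π c * π a + π c * π a * π b = 0 := by
    have h := toRelFree_assign homog_zero_family homog_zero_family (homog_family hc hc hc)
      (homog_family ha hb hb)
      (show zm F 1 * zm F 2 * zp F 1 - zm F 2 * zp F 1 * zm F 1 + zp F 1 * zm F 1 * zm F 2 ∈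
        generators F by simp [generators])
    simpa [yp, ym, zp, zm, assign, triple] using h
  -- When the signs are not all equal, a cyclic rotation moves the exceptional variable to the last
  -- place, where `plus` or `minus` applies up to a global sign.
  rcases hr with rfl | rfl <;> rcases hs with rfl | rfl <;> rcases ht with rfl | rfl
  · have h := toRelFree_assign homog_zero_family homog_zero_family (homog_family ha hb hc)
      homog_zero_family
      (show zp F 1 * zp F 2 * zp F 3 + zp F 2 * zp F 3 * zp F 1 + zp F 3 * zp F 1 * zp F 2 ∈
        generators F by simp [generators])
    simpa [yp, ym, zp, zm, assign, triple] using h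
  · linear_combination (norm := module) plus ha hb hc
  · linear_combination (norm := module) -plus hc ha hb
  · linear_combination (norm := module) minus hb hc ha
  · linear_combination (norm := module) plus hb hc ha
  · linear_combination (norm := module) -minus hc ha hb
  · linear_combination (norm := module) minus ha hb hc
  · have h := toRelFree_assign homog_zero_family homog_zero_family homog_zero_family
      (homog_family ha hb hc)
      (show zm F 1 * zm F 2 * zm F 3 + zm F 2 * zm F 3 * zm F 1 + zm F 3 * zm F 1 * zm F 2 ∈
        generators F by simp [generators])
    simpa [yp, ym, zp, zm, assign, triple] using h

/-- This and `homog_odd_jordan` produce symmetric even elements, to which `comm_of_even` applies. -/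
theorem homog_skew_jordan (ha : Hom 0 (-1) a) (hb : Hom 0 (-1) b) : Hom 0 1 (a * b + b * a) := by
  have h1 := (freeStarSuperalgebra F).mul_mem _ _ _ _ ha.1 hb.1
  have h2 := (freeStarSuperalgebra F).mul_mem _ _ _ _ hb.1 ha.1
  refine ⟨Submodule.add_mem _ h1 h2, ?_⟩
  rw [map_add, (freeStarSuperalgebra F).star_mul _ _ _ _ ha.1 hb.1,
    (freeStarSuperalgebra F).star_mul _ _ _ _ hb.1 ha.1, ha.2, hb.2]
  simp [add_comm]

theorem homog_odd_jordan (ha : Hom 1 r a) (hr : r = 1 ∨ r = -1) (hb : Hom 1 s b)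
    (hs : s = 1 ∨ s = -1) : Hom 0 1 (a * b - (r * s) • (b * a)) := by
  have h1 := (freeStarSuperalgebra F).mul_mem _ _ _ _ ha.1 hb.1
  have h2 := (freeStarSuperalgebra F).mul_mem _ _ _ _ hb.1 ha.1
  refine ⟨Submodule.sub_mem _ h1 (Submodule.smul_mem _ _ h2), ?_⟩
  have e : (1 : ZMod 2).val = 1 := rfl
  rw [map_sub, map_smul, (freeStarSuperalgebra F).star_mul _ _ _ _ ha.1 hb.1,
    (freeStarSuperalgebra F).star_mul _ _ _ _ hb.1 ha.1, ha.2, hb.2, e]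
  rcases hr with rfl | rfl <;> rcases hs with rfl | rfl <;> simp <;> abel

end Free
-- Multilinear identities of degree three, by kinds of variables.
section Evaluation

variable {F : Type*} [Field F]

/-- The multilinear polynomial in three variables with the given six coefficients. -/
def multilinear {A : Type*} [Ring A] [Algebra F A] (α : Fin 6 → F) (a b c : A) : A :=
  α 0 • (a * b * c) + α 1 • (a * c * b) + α 2 • (b * a * c) + α 3 • (b * c * a) +
    α 4 • (c * a * b) + α 5 • (c * b * a)

/-- Every multilinear identity of `M_{1,2}(F)` in three variables of the given kinds is trivial in
the quotient by the `T₂^*`-ideal. -/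
def MultilinearComplete (p q r : ZMod 2) (s t u : F) : Prop :=
  ∀ α : Fin 6 → F,
    (∀ A B C, Homog (M12 F) p s A → Homog (M12 F) q t B → Homog (M12 F) r u C →
      multilinear α A B C = 0) →
    ∀ a b c, Homog (freeStarSuperalgebra F) p s a → Homog (freeStarSuperalgebra F) q t b →
      Homog (freeStarSuperalgebra F) r u c →
      multilinear α (toRelFree F a) (toRelFree F b) (toRelFree F c) = 0

theorem multilinear_swap_left {A : Type*} [Ring A] [Algebra F A] (α : Fin 6 → F) (a b c : A) :
    multilinear ![α 2, α 3, α 0, α 1, α 5, α 4] b a c = multilinear α a b c := by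
  simp only [multilinear, Matrix.cons_val]
  abel

theorem multilinear_swap_right {A : Type*} [Ring A] [Algebra F A] (α : Fin 6 → F) (a b c : A) :
    multilinear ![α 1, α 0, α 4, α 5, α 2, α 3] a c b = multilinear α a b c := by
  simp only [multilinear, Matrix.cons_val]
  abel

variable {p q r : ZMod 2} {s t u : F}

/-- Together with `swap_right` this generates all permutations of the three variables, so each
unordered choice of kinds is treated once. -/
theorem MultilinearComplete.swap_left (h : MultilinearComplete p q r s t u) :
    MultilinearComplete q p r t s u := by
  intro α hα a b c ha hb hc
  rw [← multilinear_swap_left]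
  refine h _ (fun A B C hA hB hC => ?_) b a c hb ha hc
  rw [multilinear_swap_left]
  exact hα B A C hB hA hC

theorem MultilinearComplete.swap_right (h : MultilinearComplete p q r s t u) :
    MultilinearComplete p r q s u t := by
  intro α hα a b c ha hb hc
  rw [← multilinear_swap_right]
  refine h _ (fun A B C hA hB hC => ?_) a c b ha hc hb
  rw [multilinear_swap_right]
  exact hα A C B hA hC hB

/-- The symmetric even matrices. -/
def evenSymm (x y : F) : Matrix (Fin 3) (Fin 3) F := !![x, 0, 0; 0, y, 0; 0, 0, y]

/-- The skew even matrices. -/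
def evenSkew (x y z : F) : Matrix (Fin 3) (Fin 3) F := !![0, 0, 0; 0, x, y; 0, z, -x]

/-- The odd matrices `M` with `M^* = s M`, for `s = ± 1`. -/
def odd (s x y : F) : Matrix (Fin 3) (Fin 3) F := !![0, x, y; s * y, 0, 0; -(s * x), 0, 0]

theorem homog_evenSymm (x y : F) : Homog (M12 F) 0 1 (evenSymm x y) := by
  refine ⟨mem_matComp_zero.2 (by simp [evenSymm]), ?_⟩
  change osp F _ = _
  ext i j
  fin_cases i <;> fin_cases j <;> simp [osp, evenSymm]

theorem homog_evenSkew (x y z : F) : Homog (M12 F) 0 (-1) (evenSkew x y z) := by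
  refine ⟨mem_matComp_zero.2 (by simp [evenSkew]), ?_⟩
  change osp F _ = _
  ext i j
  fin_cases i <;> fin_cases j <;> simp [osp, evenSkew]

theorem homog_odd (hs : s = 1 ∨ s = -1) (x y : F) : Homog (M12 F) 1 s (odd s x y) := by
  refine ⟨mem_matComp_one.2 (by simp [odd]), ?_⟩
  change osp F _ = _
  ext i j
  rcases hs with rfl | rfl <;> fin_cases i <;> fin_cases j <;> simp [osp, odd]

/-- An even matrix `M` with `M^* = s M` whose restriction to the odd part is invertible. -/
theorem homog_diagonal (hs : s = 1 ∨ s = -1) :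
    Homog (M12 F) 0 s !![0, 0, 0; 0, 1, 0; 0, 0, s] := by
  rcases hs with rfl | rfl
  · exact homog_evenSymm 0 1
  · exact homog_evenSkew 1 0 0

theorem multilinear_apply (α : Fin 6 → F) (A B C : Matrix (Fin 3) (Fin 3) F) (i j : Fin 3) :
    multilinear α A B C i j = α 0 * (A * B * C) i j + α 1 * (A * C * B) i j +
      α 2 * (B * A * C) i j + α 3 * (B * C * A) i j + α 4 * (C * A * B) i j +
      α 5 * (C * B * A) i j := rfl

theorem mul_mem_even {b c : FreeStar F} (hb : b ∈ (freeStarSuperalgebra F).comp 1)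
    (hc : c ∈ (freeStarSuperalgebra F).comp 1) : b * c ∈ (freeStarSuperalgebra F).comp 0 :=
  (show (1 : ZMod 2) + 1 = 0 from rfl) ▸ (freeStarSuperalgebra F).mul_mem 1 1 b c hb hc

theorem StarVar.sign_eq (x : StarVar) : (x.sign : F) = 1 ∨ (x.sign : F) = -1 := by
  cases x <;> simp [StarVar.sign]

theorem StarVar.parity_eq (x : StarVar) : x.parity = 0 ∨ x.parity = 1 := by
  cases x <;> simp [StarVar.parity]

variable [CharZero F]

theorem complete_symm_symm_even (hs : s = 1 ∨ s = -1) :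
    MultilinearComplete (F := F) 0 0 0 1 1 s := by
  intro α hα a b c ha hb hc
  -- Two variables become the identity matrix, so the coefficients sum to 0. In the quotient all six
  -- monomials coincide.
  have h := congrFun (congrFun (hα _ _ _ (homog_evenSymm 1 1) (homog_evenSymm 1 1)
    (homog_diagonal hs)) 1) 1
  simp [multilinear_apply, evenSymm, Matrix.mul_apply, Fin.sum_univ_three] at h
  have h1 := comm_of_even ha hb.1
  have h2 := comm_of_even ha hc.1
  have h3 := comm_of_even hb hc.1
  have e1 : toRelFree F a * toRelFree F c * toRelFree F b =
    toRelFree F a * toRelFree F b * toRelFree F c := by rw [mul_assoc, ← h3, ← mul_assoc]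
  have e2 : toRelFree F b * toRelFree F c * toRelFree F a =
    toRelFree F a * toRelFree F b * toRelFree F c := by rw [mul_assoc, ← h2, ← mul_assoc, ← h1]
  simp only [multilinear, ← h1, ← h2, ← h3, e1, e2, ← add_smul]
  rw [h, zero_smul]

/-- Since `a` commutes with `b` and `c`, only the order of `b` and `c` matters. The matrix units put
$BC$ and $CB$ in different diagonal entries, separating the two orders. -/
theorem complete_symm_skew_skew : MultilinearComplete (F := F) 0 0 0 1 (-1) (-1) := by
  intro α hα a b c ha hb hc
  have h := hα _ _ _ (homog_evenSymm 1 1) (homog_evenSkew 0 1 0) (homog_evenSkew 0 0 1)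
  have k1 := congrFun (congrFun h 1) 1
  have k2 := congrFun (congrFun h 2) 2
  simp [multilinear_apply, evenSymm, evenSkew, Matrix.mul_apply, Fin.sum_univ_three] at k1 k2
  have h1 := comm_of_even ha hb.1
  have h2 := comm_of_even ha hc.1
  have e1 : toRelFree F b * toRelFree F c * toRelFree F a =
    toRelFree F a * toRelFree F b * toRelFree F c := by rw [mul_assoc, ← h2, ← mul_assoc, ← h1]
  have e2 : toRelFree F c * toRelFree F b * toRelFree F a =
    toRelFree F a * toRelFree F c * toRelFree F b := by rw [mul_assoc, ← h1, ← mul_assoc, ← h2]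
  have k3 : α 3 = -(α 0 + α 2) := eq_neg_of_add_eq_zero_right k1
  have k4 : α 5 = -(α 1 + α 4) := eq_neg_of_add_eq_zero_right k2
  simp only [multilinear, e1, e2, ← h1, ← h2, k3, k4]
  module

theorem complete_symm_even_odd (hs : s = 1 ∨ s = -1) (ht : t = 1 ∨ t = -1) :
    MultilinearComplete (F := F) 0 0 1 1 s t := by
  intro α hα a b c ha hb hc
  -- The two symmetric matrices are the block idempotents: the first isolates the monomials with `c`
  -- between `a` and `b`, the second gives the relations between the others.
  have h := hα _ _ _ (homog_evenSymm 1 0) (homog_diagonal hs) (homog_odd ht 1 1)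
  have h' := hα _ _ _ (homog_evenSymm 0 1) (homog_diagonal hs) (homog_odd ht 1 1)
  have k1 := congrFun (congrFun h 0) 1
  have k2 := congrFun (congrFun h 1) 0
  have k3 := congrFun (congrFun h' 0) 1
  have k4 := congrFun (congrFun h' 1) 0
  simp [multilinear_apply, evenSymm, odd, Matrix.mul_apply, Fin.sum_univ_three] at k1 k2 k3 k4
  have ht0 : t ≠ 0 := by rcases ht with rfl | rfl <;> simp
  have k5 := k2.resolve_right ht0
  have k6 : α 2 = -α 0 := by
    apply mul_right_cancel₀ ht0
    linear_combination k4
  have h1 := comm_of_even ha hb.1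
  have e : toRelFree F c * toRelFree F b * toRelFree F a =
    toRelFree F c * toRelFree F a * toRelFree F b := by rw [mul_assoc, ← h1, ← mul_assoc]
  have k7 := eq_neg_of_add_eq_zero_right k3
  simp only [multilinear, k1, k5, k6, k7, ← h1, e]
  module

/-- The element `a` commutes with `b * c` and `c * b`, and the monomials with `a` in the middle have
coefficient 0: the first block idempotent leaves only those in the lower block. -/
theorem complete_symm_odd_odd (hs : s = 1 ∨ s = -1) (ht : t = 1 ∨ t = -1) :
    MultilinearComplete (F := F) 0 1 1 1 s t := by
  intro α hα a b c ha hb hc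
  have h := hα _ _ _ (homog_evenSymm 1 0) (homog_odd hs 0 1) (homog_odd ht 1 0)
  have h' := hα _ _ _ (homog_evenSymm 0 1) (homog_odd hs 0 1) (homog_odd ht 1 0)
  have k1 := congrFun (congrFun h 1) 1
  have k2 := congrFun (congrFun h 2) 2
  have k3 := congrFun (congrFun h' 1) 1
  have k4 := congrFun (congrFun h' 2) 2
  simp [multilinear_apply, evenSymm, odd, Matrix.mul_apply, Fin.sum_univ_three] at k1 k2 k3 k4
  have hs0 : s ≠ 0 := by rcases hs with rfl | rfl <;> simp
  have ht0 : t ≠ 0 := by rcases ht with rfl | rfl <;> simp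
  have k5 := k1.resolve_right hs0
  have k6 := k2.resolve_right ht0
  have k7 : α 3 = -α 0 := by
    apply mul_right_cancel₀ hs0
    linear_combination k3
  have k8 : α 5 = -α 1 := by
    apply mul_right_cancel₀ ht0
    linear_combination -k4
  have e1 := comm_of_even ha (mul_mem_even hb.1 hc.1)
  have e2 := comm_of_even ha (mul_mem_even hc.1 hb.1)
  simp only [map_mul, ← mul_assoc] at e1 e2
  rw [multilinear, k5, k6, k7, k8, e1, e2]
  module

/-- The standard basis of $\mathfrak{sl}_2$, in three orders, leaves two free coefficients. They
belong to $[ab+ba,c]$ and $[ac+ca,b]$, which vanish in the quotient. -/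
theorem complete_skew_skew_skew : MultilinearComplete (F := F) 0 0 0 (-1) (-1) (-1) := by
  intro α hα a b c ha hb hc
  have h := hα _ _ _ (homog_evenSkew 1 0 0) (homog_evenSkew 0 1 0) (homog_evenSkew 0 0 1)
  have h' := hα _ _ _ (homog_evenSkew 0 1 0) (homog_evenSkew 1 0 0) (homog_evenSkew 0 0 1)
  have h'' := hα _ _ _ (homog_evenSkew 0 1 0) (homog_evenSkew 0 0 1) (homog_evenSkew 1 0 0)
  have k1 := congrFun (congrFun h 1) 1
  have k2 := congrFun (congrFun h 2) 2
  have k3 := congrFun (congrFun h' 1) 1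
  have k4 := congrFun (congrFun h'' 1) 1
  simp [multilinear_apply, evenSkew, Matrix.mul_apply, Fin.sum_univ_three] at k1 k2 k3 k4
  have l3 : α 3 = -α 1 := by linear_combination k1 + k3
  have l4 : α 4 = α 1 - α 0 := by linear_combination k4
  have l5 : α 5 = -α 0 := by linear_combination k4 - k2
  have l2 : α 2 = α 0 - α 1 := by linear_combination l3 - k1
  have e1 := comm_of_even (homog_skew_jordan ha hb) hc.1
  have e2 := comm_of_even (homog_skew_jordan ha hc) hb.1
  simp only [map_mul, map_add, mul_add, add_mul, ← mul_assoc] at e1 e2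
  rw [multilinear, l2, l3, l4, l5]
  linear_combination (norm := module) α 0 • e1 + α 1 • e2

/-- The two monomials with the odd variable in the middle vanish by `skew_odd_skew`; the other four
take their values in different entries, so their coefficients are 0. -/
theorem complete_skew_skew_odd (hs : s = 1 ∨ s = -1) :
    MultilinearComplete (F := F) 0 0 1 (-1) (-1) s := by
  intro α hα a b c ha hb hc
  have h := hα _ _ _ (homog_evenSkew 0 1 0) (homog_evenSkew 0 0 1) (homog_odd hs 1 1)
  have k1 := congrFun (congrFun h 1) 0
  have k2 := congrFun (congrFun h 2) 0
  have k3 := congrFun (congrFun h 0) 1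
  have k4 := congrFun (congrFun h 0) 2
  simp [multilinear_apply, evenSkew, odd, Matrix.mul_apply, Fin.sum_univ_three] at k1 k2 k3 k4
  have hs0 : s ≠ 0 := by rcases hs with rfl | rfl <;> simp
  rw [multilinear, k1.resolve_right hs0, k2.resolve_right hs0, k3, k4,
    skew_odd_skew ha hc hs hb, skew_odd_skew hb hc hs ha]
  simp

/-- Two coefficients stay free: `α 0` goes with the commutator of `a` and $bc-st\,cb$, and `α 2`
with `odd_skew_odd`. -/
theorem complete_skew_odd_odd (hs : s = 1 ∨ s = -1) (ht : t = 1 ∨ t = -1) :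
    MultilinearComplete (F := F) 0 1 1 (-1) s t := by
  intro α hα a b c ha hb hc
  have h := hα _ _ _ (homog_evenSkew 1 0 0) (homog_odd hs 0 1) (homog_odd ht 1 0)
  have h' := hα _ _ _ (homog_evenSkew 0 1 0) (homog_odd hs 0 1) (homog_odd ht 1 0)
  have k1 := congrFun (congrFun h 0) 0
  have k2 := congrFun (congrFun h 1) 1
  have k3 := congrFun (congrFun h 2) 2
  have k4 := congrFun (congrFun h' 1) 2
  simp [multilinear_apply, evenSkew, odd, Matrix.mul_apply, Fin.sum_univ_three] at k1 k2 k3 k4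
  have hs1 : s * s = 1 := by rcases hs with rfl | rfl <;> simp
  have ht1 : t * t = 1 := by rcases ht with rfl | rfl <;> simp
  have l3 : α 3 = -α 0 := by linear_combination s * k2 - (α 0 + α 3) * hs1
  have l1 : α 1 = -(s * t) * α 0 := by linear_combination s * t * l3 - t * k4 - α 1 * ht1
  have l5 : α 5 = s * t * α 0 := by linear_combination t * k3 - l1 - (α 1 + α 5) * ht1
  have l4 : α 4 = -(s * t) * α 2 := by linear_combination s * k1 - α 4 * hs1
  have e1 := comm_of_even (homog_odd_jordan hb hs hc ht) ha.1
  have e2 := odd_skew_odd hb hs ha hc ht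
  simp only [map_mul, map_smul, map_sub, mul_sub, sub_mul, ← mul_assoc, smul_mul_assoc,
    mul_smul_comm] at e1
  rw [multilinear, l1, l3, l4, l5]
  linear_combination (norm := module) (-α 0) • e1 + α 2 • e2

/-- The six monomials form two cyclic orbits. Evaluation leaves one free coefficient for each,
matching `odd_odd_odd` for the orders `a, b, c` and `a, c, b`. -/
theorem complete_odd_odd_odd (hr : s = 1 ∨ s = -1) (hs : t = 1 ∨ t = -1) (ht : u = 1 ∨ u = -1) :
    MultilinearComplete (F := F) 1 1 1 s t u := by
  intro α hα a b c ha hb hc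
  have h := hα _ _ _ (homog_odd hr 1 0) (homog_odd hs 1 0) (homog_odd ht 0 1)
  have h' := hα _ _ _ (homog_odd hr 1 0) (homog_odd hs 0 1) (homog_odd ht 1 0)
  have k1 := congrFun (congrFun h 0) 1
  have k2 := congrFun (congrFun h' 0) 1
  have k3 := congrFun (congrFun h 2) 0
  have k4 := congrFun (congrFun h' 2) 0
  simp [multilinear_apply, odd, Matrix.mul_apply, Fin.sum_univ_three] at k1 k2 k3 k4
  have l : α 3 = t * u * α 0 ∧ α 4 = s * t * α 0 ∧ α 5 = t * u * α 1 ∧ α 2 = s * u * α 1 := by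
    rcases hr with rfl | rfl <;> rcases hs with rfl | rfl <;> rcases ht with rfl | rfl <;>
      (clear hα ha hb hc h h'; refine ⟨?_, ?_, ?_, ?_⟩ <;> grind)
  obtain ⟨l3, l4, l5, l2⟩ := l
  have e1 := odd_odd_odd ha hr hb hs hc ht
  have e2 := odd_odd_odd ha hr hc ht hb hs
  rw [multilinear, l2, l3, l4, l5]
  linear_combination (norm := module) α 0 • e1 + α 1 • e2

theorem complete_symm_any (y z : StarVar) :
    MultilinearComplete (F := F) 0 y.parity z.parity 1 y.sign z.sign := by
  cases y <;> cases z <;>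
    simp only [StarVar.parity, StarVar.sign, Int.cast_one, Int.cast_neg] <;>
    first
      | exact complete_symm_symm_even (by simp)
      | exact (complete_symm_symm_even (by simp)).swap_right
      | exact complete_symm_skew_skew
      | exact complete_symm_even_odd (by simp) (by simp)
      | exact (complete_symm_even_odd (by simp) (by simp)).swap_right
      | exact complete_symm_odd_odd (by simp) (by simp)

theorem complete_skew_any (y z : StarVar) :
    MultilinearComplete (F := F) 0 y.parity z.parity (-1) y.sign z.sign := by
  -- Cases containing a symmetric even variable are permutations of those already settled. Only the
  -- kind of a variable matters, so index 0 serves for all.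
  have h1 := fun x => (complete_symm_any (F := F) (.yMinus 0) x).swap_left
  have h2 := fun x => (h1 x).swap_right
  simp only [StarVar.parity, StarVar.sign, Int.cast_one, Int.cast_neg] at h1 h2
  cases y <;> cases z <;>
    simp only [StarVar.parity, StarVar.sign, Int.cast_one, Int.cast_neg] <;>
    first
      | exact complete_skew_skew_skew
      | exact complete_skew_skew_odd (by simp)
      | exact (complete_skew_skew_odd (by simp)).swap_right
      | exact complete_skew_odd_odd (by simp) (by simp)
      | simpa [StarVar.parity, StarVar.sign] using h1 (.yPlus 0)
      | simpa [StarVar.parity, StarVar.sign] using h1 (.yMinus 0)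
      | simpa [StarVar.parity, StarVar.sign] using h1 (.zPlus 0)
      | simpa [StarVar.parity, StarVar.sign] using h1 (.zMinus 0)
      | simpa [StarVar.parity, StarVar.sign] using h2 (.yMinus 0)
      | simpa [StarVar.parity, StarVar.sign] using h2 (.zPlus 0)
      | simpa [StarVar.parity, StarVar.sign] using h2 (.zMinus 0)

theorem complete_even_any (x y z : StarVar) (hx : x.parity = 0) :
    MultilinearComplete (F := F) x.parity y.parity z.parity x.sign y.sign z.sign := by
  cases x with
  | yPlus i => simpa [StarVar.parity, StarVar.sign] using complete_symm_any y z
  | yMinus i => simpa [StarVar.parity, StarVar.sign] using complete_skew_any y z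
  | zPlus i => exact absurd hx one_ne_zero
  | zMinus i => exact absurd hx one_ne_zero

theorem multilinearComplete (x y z : StarVar) :
    MultilinearComplete (F := F) x.parity y.parity z.parity x.sign y.sign z.sign := by
  rcases x.parity_eq with hx | hx
  · exact complete_even_any x y z hx
  rcases y.parity_eq with hy | hy
  · exact (complete_even_any y x z hy).swap_left
  rcases z.parity_eq with hz | hz
  · exact (complete_even_any z x y hz).swap_left.swap_right
  rw [hx, hy, hz]
  exact complete_odd_odd_odd x.sign_eq y.sign_eq z.sign_eq

end Evaluation
-- The ten generators vanish on $M_{1,2}(F)$.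
section Soundness

variable {F : Type*} [Field F] {M : Matrix (Fin 3) (Fin 3) F} {s : F}

theorem Homog.apply_eq {p : ZMod 2} (h : Homog (M12 F) p s M) (i j : Fin 3) :
    osp F M i j = s * M i j :=
  congrFun (congrFun h.2 i) j

theorem Homog.eq_evenSymm [CharZero F] (h : Homog (M12 F) 0 1 M) : ∃ x y, M = evenSymm x y := by
  obtain ⟨h1, h2, h3, h4⟩ := mem_matComp_zero.1 h.1
  have k1 := h.apply_eq 1 1
  have k2 := h.apply_eq 1 2
  have k3 := h.apply_eq 2 1
  simp [osp, neg_eq_self] at k1 k2 k3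
  refine ⟨M 0 0, M 1 1, ?_⟩
  ext i j
  fin_cases i <;> fin_cases j <;> simp [evenSymm, *]

theorem Homog.eq_evenSkew [CharZero F] (h : Homog (M12 F) 0 (-1) M) : ∃ x y z, M = evenSkew x y z := by
  obtain ⟨h1, h2, h3, h4⟩ := mem_matComp_zero.1 h.1
  have k0 := h.apply_eq 0 0
  have k1 := h.apply_eq 1 1
  simp [osp, self_eq_neg] at k0 k1
  refine ⟨M 1 1, M 1 2, M 2 1, ?_⟩
  ext i j
  fin_cases i <;> fin_cases j <;> simp [evenSkew, *]

theorem Homog.eq_odd (h : Homog (M12 F) 1 s M) : ∃ x y, M = odd s x y := by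
  obtain ⟨h1, h2, h3, h4, h5⟩ := mem_matComp_one.1 h.1
  have k1 := h.apply_eq 0 1
  have k2 := h.apply_eq 0 2
  simp [osp] at k1 k2
  refine ⟨M 0 1, M 0 2, ?_⟩
  ext i j
  fin_cases i <;> fin_cases j <;> simp [odd, h1, h2, h3, h4, h5, k2, ← k1]

set_option maxHeartbeats 4000000 in
theorem isStarIdentity_of_mem_generators [CharZero F] {g : FreeStar F} (hg : g ∈ generators F) :
    IsStarIdentity (M12 F) g := by
  intro ρ hρ
  have hyp (i : ℕ) : ∃ x y, ρ (.yPlus i) = evenSymm x y :=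
    Homog.eq_evenSymm (by simpa [StarVar.sign, StarVar.parity, Homog] using hρ (.yPlus i))
  have hym (i : ℕ) : ∃ x y z, ρ (.yMinus i) = evenSkew x y z :=
    Homog.eq_evenSkew (by simpa [StarVar.sign, StarVar.parity, Homog] using hρ (.yMinus i))
  have hzp (i : ℕ) : ∃ x y, ρ (.zPlus i) = odd 1 x y :=
    Homog.eq_odd (by simpa [StarVar.sign, StarVar.parity, Homog] using hρ (.zPlus i))
  have hzm (i : ℕ) : ∃ x y, ρ (.zMinus i) = odd (-1) x y :=
    Homog.eq_odd (by simpa [StarVar.sign, StarVar.parity, Homog] using hρ (.zMinus i))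
  choose a b ha using hyp
  choose c d e hc using hym
  choose k l hk using hzp
  choose m n hm using hzm
  clear hρ
  rcases hg with rfl | rfl | rfl | rfl | rfl | rfl | rfl | rfl | rfl | rfl <;>
    simp only [yv, yp, ym, zp, zm, map_sub, map_add, map_mul, map_smul,
      FreeAlgebra.lift_ι_apply, ha, hc, hk, hm] <;>
    ext i j <;> fin_cases i <;> fin_cases j <;>
    simp [evenSymm, evenSkew, odd, Matrix.mul_apply, Fin.sum_univ_three] <;> ring

end Soundness

/-! ### Polynomials of degree at most three and their polarization. -/

section Polarization

variable {F : Type*} [Field F] {A : Type*} [Ring A] [Algebra F A]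

/-- The evaluation of the quadratic form with coefficients `c`, polarized. -/
noncomputable def quadratic (c : StarVar × StarVar →₀ F) (u v : StarVar → A) : A :=
  Finsupp.linearCombination F (fun p : StarVar × StarVar => u p.1 * v p.2) c

/-- The evaluation of the cubic form with coefficients `c`, polarized. -/
noncomputable def cubic (c : StarVar × StarVar × StarVar →₀ F) (u v w : StarVar → A) : A :=
  Finsupp.linearCombination F (fun p : StarVar × StarVar × StarVar => u p.1 * v p.2.1 * w p.2.2) c

/-- The evaluation of a polynomial of degree at most `3`. -/
noncomputable def cubicPoly (c₀ : F) (c₁ : StarVar →₀ F) (c₂ : StarVar × StarVar →₀ F)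
    (c₃ : StarVar × StarVar × StarVar →₀ F) (u : StarVar → A) : A :=
  algebraMap F A c₀ + Finsupp.linearCombination F u c₁ + quadratic c₂ u u + cubic c₃ u u u

theorem exists_eq_linear {f : FreeStar F} (hf : f ∈ degreeLE F 1) :
    ∃ (c₀ : F) (c₁ : StarVar →₀ F),
      f = cubicPoly c₀ c₁ 0 0 (FreeAlgebra.ι F : StarVar → FreeStar F) := by
  induction hf using Submodule.span_induction with
  | mem x hx =>
    obtain ⟨w, hw, rfl⟩ := hx
    match w, hw with
    | [], _ => exact ⟨1, 0, by simp [cubicPoly, quadratic, cubic, monom]⟩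
    | [x], _ => exact ⟨0, Finsupp.single x 1, by simp [cubicPoly, quadratic, cubic, monom]⟩
    | _ :: _ :: _, h => simp at h
  | zero => exact ⟨0, 0, by simp [cubicPoly, quadratic, cubic]⟩
  | add x y _ _ hx hy =>
    obtain ⟨c₀, c₁, rfl⟩ := hx
    obtain ⟨d₀, d₁, rfl⟩ := hy
    refine ⟨c₀ + d₀, c₁ + d₁, ?_⟩
    simp only [cubicPoly, quadratic, cubic, map_add, map_zero]
    abel
  | smul r x _ hx =>
    obtain ⟨c₀, c₁, rfl⟩ := hx
    refine ⟨r • c₀, r • c₁, ?_⟩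
    simp only [cubicPoly, quadratic, cubic, map_smul, smul_add, Algebra.algebraMap_eq_smul_one,
      smul_assoc, map_zero, smul_zero]

theorem exists_eq_cubicPoly {f : FreeStar F} (hf : f ∈ degreeLE F 3) :
    ∃ (c₀ : F) (c₁ : StarVar →₀ F) (c₂ : StarVar × StarVar →₀ F)
      (c₃ : StarVar × StarVar × StarVar →₀ F),
      f = cubicPoly c₀ c₁ c₂ c₃ (FreeAlgebra.ι F : StarVar → FreeStar F) := by
  induction hf using Submodule.span_induction with
  | mem x hx =>
    obtain ⟨w, hw, rfl⟩ := hx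
    match w, hw with
    | [], _ => exact ⟨1, 0, 0, 0, by simp [cubicPoly, quadratic, cubic, monom]⟩
    | [x], _ => exact ⟨0, Finsupp.single x 1, 0, 0, by simp [cubicPoly, quadratic, cubic, monom]⟩
    | [x, y], _ =>
      exact ⟨0, 0, Finsupp.single (x, y) 1, 0, by simp [cubicPoly, quadratic, cubic, monom]⟩
    | [x, y, z], _ =>
      exact ⟨0, 0, 0, Finsupp.single (x, y, z) 1, by
        simp [cubicPoly, quadratic, cubic, monom, mul_assoc]⟩
    | _ :: _ :: _ :: _ :: _, h =>
      simp at h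
      omega
  | zero => exact ⟨0, 0, 0, 0, by simp [cubicPoly, quadratic, cubic]⟩
  | add x y _ _ hx hy =>
    obtain ⟨c₀, c₁, c₂, c₃, rfl⟩ := hx
    obtain ⟨d₀, d₁, d₂, d₃, rfl⟩ := hy
    refine ⟨c₀ + d₀, c₁ + d₁, c₂ + d₂, c₃ + d₃, ?_⟩
    simp only [cubicPoly, quadratic, cubic, map_add]
    abel
  | smul r x _ hx =>
    obtain ⟨c₀, c₁, c₂, c₃, rfl⟩ := hx
    refine ⟨r • c₀, r • c₁, r • c₂, r • c₃, ?_⟩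
    simp only [cubicPoly, quadratic, cubic, map_smul, smul_add, Algebra.algebraMap_eq_smul_one,
      smul_assoc]

theorem map_cubicPoly {B : Type*} [Ring B] [Algebra F B] (φ : A →ₐ[F] B) (c₀ : F)
    (c₁ : StarVar →₀ F) (c₂ : StarVar × StarVar →₀ F) (c₃ : StarVar × StarVar × StarVar →₀ F)
    (u : StarVar → A) :
    φ (cubicPoly c₀ c₁ c₂ c₃ u) = cubicPoly c₀ c₁ c₂ c₃ (φ ∘ u) := by
  simp [cubicPoly, quadratic, cubic, Finsupp.linearCombination_apply, Finsupp.sum]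

theorem linear_add (c : StarVar →₀ F) (u v : StarVar → A) :
    Finsupp.linearCombination F (u + v) c =
      Finsupp.linearCombination F u c + Finsupp.linearCombination F v c := by
  simp [Finsupp.linearCombination_apply, Finsupp.sum, Finset.sum_add_distrib]

theorem linear_zero (c : StarVar →₀ F) :
    Finsupp.linearCombination F (0 : StarVar → A) c = 0 := by
  simp

section Multiadditive

variable (c : StarVar × StarVar →₀ F) (d : StarVar × StarVar × StarVar →₀ F)
  (u u' v v' w w' : StarVar → A)

theorem quadratic_add_left : quadratic c (u + u') v = quadratic c u v + quadratic c u' v := by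
  simp [quadratic, Finsupp.linearCombination_apply, Finsupp.sum, Finset.sum_add_distrib, add_mul]

theorem quadratic_add_right : quadratic c u (v + v') = quadratic c u v + quadratic c u v' := by
  simp [quadratic, Finsupp.linearCombination_apply, Finsupp.sum, Finset.sum_add_distrib, mul_add]

theorem quadratic_zero_left : quadratic c 0 v = 0 := by
  simp [quadratic, Finsupp.linearCombination_apply]

theorem cubic_add_left : cubic d (u + u') v w = cubic d u v w + cubic d u' v w := by
  simp [cubic, Finsupp.linearCombination_apply, Finsupp.sum, Finset.sum_add_distrib, add_mul]

theorem cubic_add_middle : cubic d u (v + v') w = cubic d u v w + cubic d u v' w := by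
  simp [cubic, Finsupp.linearCombination_apply, Finsupp.sum, Finset.sum_add_distrib, add_mul,
    mul_add]

theorem cubic_add_right : cubic d u v (w + w') = cubic d u v w + cubic d u v w' := by
  simp [cubic, Finsupp.linearCombination_apply, Finsupp.sum, Finset.sum_add_distrib, mul_add]

theorem cubic_zero_left : cubic d 0 v w = 0 := by
  simp [cubic, Finsupp.linearCombination_apply]

end Multiadditive

section Single

open scoped Classical in
theorem linear_single (c : StarVar →₀ F) (x : StarVar) (a : A) :
    Finsupp.linearCombination F (Pi.single x a : StarVar → A) c = c x • a := by
  rw [Finsupp.linearCombination_apply, Finsupp.sum, Finset.sum_eq_single x]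
  · simp
  · intro y _ hy
    simp [hy]
  · intro hx
    simp [Finsupp.notMem_support_iff.1 hx]

open scoped Classical in
theorem quadratic_single (c : StarVar × StarVar →₀ F) (x y : StarVar) (a b : A) :
    quadratic c (Pi.single x a) (Pi.single y b) = c (x, y) • (a * b) := by
  rw [quadratic, Finsupp.linearCombination_apply, Finsupp.sum, Finset.sum_eq_single (x, y)]
  · simp
  · rintro ⟨x', y'⟩ _ h
    by_cases hx : x' = x
    · have hy : y' ≠ y := fun hy => h (by rw [hx, hy])
      simp [hy]
    · simp [hx]
  · intro hx
    simp [Finsupp.notMem_support_iff.1 hx]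

open scoped Classical in
theorem cubic_single (c : StarVar × StarVar × StarVar →₀ F) (x y z : StarVar) (a b d : A) :
    cubic c (Pi.single x a) (Pi.single y b) (Pi.single z d) = c (x, y, z) • (a * b * d) := by
  rw [cubic, Finsupp.linearCombination_apply, Finsupp.sum, Finset.sum_eq_single (x, y, z)]
  · simp
  · rintro ⟨x', y', z'⟩ _ h
    by_cases hx : x' = x
    · by_cases hy : y' = y
      · have hz : z' ≠ z := fun hz => h (by rw [hx, hy, hz])
        simp [hz]
      · simp [hy]
    · simp [hx]
  · intro hx
    simp [Finsupp.notMem_support_iff.1 hx]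

end Single

/-- The coefficients of the multilinear polynomial obtained by polarizing a cubic form. -/
def polarCoeff (c : StarVar × StarVar × StarVar →₀ F) (x y z : StarVar) : Fin 6 → F :=
  ![c (x, y, z), c (x, z, y), c (y, x, z), c (y, z, x), c (z, x, y), c (z, y, x)]

/-- Summing the polarized form over all triples of variables counts each term six times. This is
applied both to matrices and to `RelFree`. -/
theorem cubic_eq_zero [CharZero F] {c : StarVar × StarVar × StarVar →₀ F} {u : StarVar → A}
    (h : ∀ x y z, multilinear (polarCoeff c x y z) (u x) (u y) (u z) = 0) :
    cubic c u u u = 0 := by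
  classical
  -- A single finite set for all three positions makes the sum symmetric, so its indices can be
  -- permuted freely.
  let s : Finset StarVar := c.support.image (fun p => p.1) ∪
    (c.support.image (fun p => p.2.1) ∪ c.support.image (fun p => p.2.2))
  let T : StarVar → StarVar → StarVar → A := fun x y z => c (x, y, z) • (u x * u y * u z)
  have e : cubic c u u u = ∑ x ∈ s, ∑ y ∈ s, ∑ z ∈ s, T x y z := by
    rw [cubic, Finsupp.linearCombination_apply, Finsupp.sum]
    simp_rw [← Finset.sum_product' s s, ← Finset.sum_product']
    refine Finset.sum_subset ?_ ?_
    · intro p hp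
      simp only [Finset.mem_product]
      refine ⟨?_, ?_, ?_⟩
      · exact Finset.mem_union_left _ (Finset.mem_image_of_mem _ hp)
      · exact Finset.mem_union_right _ (Finset.mem_union_left _ (Finset.mem_image_of_mem _ hp))
      · exact Finset.mem_union_right _ (Finset.mem_union_right _ (Finset.mem_image_of_mem _ hp))
    · intro p _ hp
      rw [Finsupp.notMem_support_iff.1 hp, zero_smul]
  have e1 (G : StarVar → StarVar → StarVar → A) :
      ∑ x ∈ s, ∑ y ∈ s, ∑ z ∈ s, G x z y = ∑ x ∈ s, ∑ y ∈ s, ∑ z ∈ s, G x y z :=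
    Finset.sum_congr rfl fun x _ => Finset.sum_comm
  have e2 (G : StarVar → StarVar → StarVar → A) :
      ∑ x ∈ s, ∑ y ∈ s, ∑ z ∈ s, G y x z = ∑ x ∈ s, ∑ y ∈ s, ∑ z ∈ s, G x y z :=
    Finset.sum_comm
  have key : (6 : F) • cubic c u u u =
      ∑ x ∈ s, ∑ y ∈ s, ∑ z ∈ s, multilinear (polarCoeff c x y z) (u x) (u y) (u z) := by
    have f1 := e1 T
    have f2 := e2 T
    have f3 := e2 fun x y z => T x z y
    have f4 := e1 fun x y z => T y x z
    have f5 := e1 fun x y z => T y z x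
    simp only [multilinear, polarCoeff, Matrix.cons_val, Finset.sum_add_distrib]
    change _ = ∑ x ∈ s, ∑ y ∈ s, ∑ z ∈ s, T x y z + ∑ x ∈ s, ∑ y ∈ s, ∑ z ∈ s, T x z y +
      ∑ x ∈ s, ∑ y ∈ s, ∑ z ∈ s, T y x z + ∑ x ∈ s, ∑ y ∈ s, ∑ z ∈ s, T y z x +
      ∑ x ∈ s, ∑ y ∈ s, ∑ z ∈ s, T z x y + ∑ x ∈ s, ∑ y ∈ s, ∑ z ∈ s, T z y x
    rw [f5, f4, f3, f2, f1, ← e]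
    module
  simp only [h, Finset.sum_const_zero] at key
  exact (smul_eq_zero.1 key).resolve_left (by norm_num)

theorem quadratic_eq_zero [CharZero F] {c : StarVar × StarVar →₀ F} {u : StarVar → A}
    (h : ∀ x y, c (x, y) • (u x * u y) + c (y, x) • (u y * u x) = 0) :
    quadratic c u u = 0 := by
  classical
  let s : Finset StarVar := c.support.image (fun p => p.1) ∪ c.support.image (fun p => p.2)
  have e : quadratic c u u = ∑ x ∈ s, ∑ y ∈ s, c (x, y) • (u x * u y) := by
    rw [quadratic, Finsupp.linearCombination_apply, Finsupp.sum, ← Finset.sum_product']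
    refine Finset.sum_subset ?_ ?_
    · intro p hp
      simp only [Finset.mem_product]
      exact ⟨Finset.mem_union_left _ (Finset.mem_image_of_mem _ hp),
        Finset.mem_union_right _ (Finset.mem_image_of_mem _ hp)⟩
    · intro p _ hp
      rw [Finsupp.notMem_support_iff.1 hp, zero_smul]
  have key : (2 : F) • quadratic c u u =
      ∑ x ∈ s, ∑ y ∈ s, (c (x, y) • (u x * u y) + c (y, x) • (u y * u x)) := by
    simp only [Finset.sum_add_distrib]
    rw [Finset.sum_comm (f := fun x y => c (y, x) • (u y * u x)), ← e, two_smul]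
  simp only [h, Finset.sum_const_zero] at key
  exact (smul_eq_zero.1 key).resolve_left (by norm_num)

end Polarization

/-! ### From identities of degree at most three to the $T_2^*$-ideal. -/

section Completeness

variable {F : Type*} [Field F] {c₀ : F} {c₁ : StarVar →₀ F} {c₂ : StarVar × StarVar →₀ F}
  {c₃ : StarVar × StarVar × StarVar →₀ F}

/-- A substitution of the variables by matrices of the matching kinds. -/
def Admissible (ρ : StarVar → Matrix (Fin 3) (Fin 3) F) : Prop :=
  ∀ x, Homog (M12 F) x.parity (x.sign : F) (ρ x)

theorem Admissible.zero : Admissible (0 : StarVar → Matrix (Fin 3) (Fin 3) F) :=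
  fun _ => Homog.zero

theorem Admissible.add {ρ σ : StarVar → Matrix (Fin 3) (Fin 3) F} (h : Admissible ρ)
    (h' : Admissible σ) : Admissible (ρ + σ) :=
  fun x => (h x).add (h' x)

open scoped Classical in
theorem admissible_single {x : StarVar} {M : Matrix (Fin 3) (Fin 3) F}
    (h : Homog (M12 F) x.parity (x.sign : F) M) : Admissible (Pi.single x M) := by
  intro y
  by_cases hy : y = x
  · subst hy
    simpa using h
  · rw [Pi.single_eq_of_ne hy]
    exact Homog.zero

theorem exists_homog_ne_zero (x : StarVar) :
    ∃ M, Homog (M12 F) x.parity (x.sign : F) M ∧ M ≠ 0 := by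
  cases x with
  | yPlus i =>
    refine ⟨evenSymm 1 1, ?_, fun h => ?_⟩
    · simpa [StarVar.sign, StarVar.parity] using homog_evenSymm 1 1
    · simpa [evenSymm] using congrFun (congrFun h 1) 1
  | yMinus i =>
    refine ⟨evenSkew 1 0 0, ?_, fun h => ?_⟩
    · simpa [StarVar.sign, StarVar.parity] using homog_evenSkew 1 0 0
    · simpa [evenSkew] using congrFun (congrFun h 1) 1
  | zPlus i =>
    refine ⟨odd 1 1 0, ?_, fun h => ?_⟩
    · simpa [StarVar.sign, StarVar.parity] using homog_odd (Or.inl rfl) 1 0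
    · simpa [odd] using congrFun (congrFun h 0) 1
  | zMinus i =>
    refine ⟨odd (-1) 1 0, ?_, fun h => ?_⟩
    · simpa [StarVar.sign, StarVar.parity] using homog_odd (Or.inr rfl) 1 0
    · simpa [odd] using congrFun (congrFun h 0) 1

/-- The zero substitution isolates `c₀`; a nonzero matrix in a single variable then isolates its
coefficient. -/
theorem linear_eq_zero (h : ∀ ρ : StarVar → Matrix (Fin 3) (Fin 3) F, Admissible ρ →
    cubicPoly c₀ c₁ 0 0 ρ = 0) : c₀ = 0 ∧ c₁ = 0 := by
  classical
  have h0 := h 0 Admissible.zero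
  simp only [cubicPoly, linear_zero, quadratic, cubic, map_zero, add_zero] at h0
  have hc : c₀ = 0 := by simpa [Matrix.algebraMap_matrix_apply] using congrFun (congrFun h0 0) 0
  subst hc
  refine ⟨rfl, Finsupp.ext fun x => ?_⟩
  obtain ⟨M, hM, hM0⟩ := exists_homog_ne_zero (F := F) x
  have h1 := h _ (admissible_single hM)
  simp only [cubicPoly, linear_single, quadratic, cubic, map_zero, add_zero, zero_add] at h1
  exact (smul_eq_zero.1 h1).resolve_right hM0

theorem multilinear_polarCoeff (h : ∀ ρ : StarVar → Matrix (Fin 3) (Fin 3) F, Admissible ρ →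
    cubicPoly c₀ c₁ c₂ c₃ ρ = 0) (x y z : StarVar) {A B C : Matrix (Fin 3) (Fin 3) F}
    (hA : Homog (M12 F) x.parity (x.sign : F) A) (hB : Homog (M12 F) y.parity (y.sign : F) B)
    (hC : Homog (M12 F) z.parity (z.sign : F) C) :
    multilinear (polarCoeff c₃ x y z) A B C = 0 := by
  classical
  have ha := admissible_single hA
  have hb := admissible_single hB
  have hc := admissible_single hC
  have h1 := h _ ((ha.add hb).add hc)
  have h2 := h _ (ha.add hb)
  have h3 := h _ (ha.add hc)
  have h4 := h _ (hb.add hc)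
  have h5 := h _ ha
  have h6 := h _ hb
  have h7 := h _ hc
  have h8 := h _ Admissible.zero
  simp only [cubicPoly, linear_add, linear_zero, quadratic_add_left, quadratic_add_right,
    quadratic_zero_left, cubic_add_left, cubic_add_middle, cubic_add_right, cubic_zero_left]
    at h1 h2 h3 h4 h5 h6 h7 h8
  simp only [multilinear, polarCoeff, Matrix.cons_val, ← cubic_single]
  -- Third difference by inclusion and exclusion: terms of degree at most two cancel. Because
  -- substitutions are added, this stays valid when some of `x`, `y`, `z` coincide.
  linear_combination (norm := module) h1 - h2 - h3 - h4 + h5 + h6 + h7 - h8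

theorem quadratic_polar (h : ∀ ρ : StarVar → Matrix (Fin 3) (Fin 3) F, Admissible ρ →
    cubicPoly c₀ c₁ c₂ 0 ρ = 0) (x y : StarVar) {A B : Matrix (Fin 3) (Fin 3) F}
    (hA : Homog (M12 F) x.parity (x.sign : F) A) (hB : Homog (M12 F) y.parity (y.sign : F) B) :
    c₂ (x, y) • (A * B) + c₂ (y, x) • (B * A) = 0 := by
  classical
  have ha := admissible_single hA
  have hb := admissible_single hB
  have h1 := h _ (ha.add hb)
  have h2 := h _ ha
  have h3 := h _ hb
  have h4 := h _ Admissible.zero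
  simp only [cubicPoly, linear_add, linear_zero, quadratic_add_left, quadratic_add_right,
    quadratic_zero_left, cubic, map_zero] at h1 h2 h3 h4
  simp only [← quadratic_single]
  linear_combination (norm := module) h1 - h2 - h3 + h4

theorem toRelFree_cubicPoly [CharZero F] (h : ∀ ρ : StarVar → Matrix (Fin 3) (Fin 3) F, Admissible ρ →
    cubicPoly c₀ c₁ c₂ c₃ ρ = 0) :
    toRelFree F (cubicPoly c₀ c₁ c₂ c₃ (FreeAlgebra.ι F)) = 0 := by
  have h3 := multilinear_polarCoeff h
  have h' : ∀ ρ : StarVar → Matrix (Fin 3) (Fin 3) F, Admissible ρ →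
      cubicPoly c₀ c₁ c₂ 0 ρ = 0 := by
    intro ρ hρ
    have k := h ρ hρ
    rw [cubicPoly, cubic_eq_zero fun x y z => h3 x y z (hρ x) (hρ y) (hρ z)] at k
    simpa [cubicPoly, cubic] using k
  have h2 := quadratic_polar h'
  have h'' : ∀ ρ : StarVar → Matrix (Fin 3) (Fin 3) F, Admissible ρ →
      cubicPoly c₀ c₁ 0 0 ρ = 0 := by
    intro ρ hρ
    have k := h' ρ hρ
    rw [cubicPoly, quadratic_eq_zero fun x y => h2 x y (hρ x) (hρ y)] at k
    simpa [cubicPoly, cubic, quadratic] using k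
  obtain ⟨rfl, rfl⟩ := linear_eq_zero h''
  have hone : Homog (freeStarSuperalgebra F) (StarVar.yPlus 0).parity
      ((StarVar.yPlus 0).sign : F) 1 := by
    simpa [StarVar.parity, StarVar.sign] using homog_one (F := F)
  have q2 : quadratic c₂ (toRelFree F ∘ FreeAlgebra.ι F) (toRelFree F ∘ FreeAlgebra.ι F) = 0 := by
    refine quadratic_eq_zero fun x y => ?_
    -- The quadratic identity is multiplied on the right by a symmetric even variable, which is
    -- replaced by 1 in the quotient; only the monomials `a * b * c` and `b * a * c` occur.
    have k := multilinearComplete x y (.yPlus 0) ![c₂ (x, y), 0, c₂ (y, x), 0, 0, 0]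
      (fun A B C hA hB _ => by
        have e := congrArg (· * C) (h2 x y hA hB)
        simpa [multilinear, add_mul] using e) _ _ _ (homog_ι x) (homog_ι y) hone
    simpa [multilinear] using k
  have q3 : cubic c₃ (toRelFree F ∘ FreeAlgebra.ι F) (toRelFree F ∘ FreeAlgebra.ι F)
      (toRelFree F ∘ FreeAlgebra.ι F) = 0 :=
    cubic_eq_zero fun x y z => multilinearComplete x y z _
      (fun A B C hA hB hC => h3 x y z hA hB hC) _ _ _ (homog_ι x) (homog_ι y) (homog_ι z)
  rw [map_cubicPoly, cubicPoly, q2, q3]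
  simp

theorem cubicPoly_eq_zero_of_isStarIdentity
    (h : IsStarIdentity (M12 F) (cubicPoly c₀ c₁ c₂ c₃ (FreeAlgebra.ι F)))
    (ρ : StarVar → Matrix (Fin 3) (Fin 3) F) (hρ : Admissible ρ) :
    cubicPoly c₀ c₁ c₂ c₃ ρ = 0 := by
  have k := h ρ hρ
  rwa [map_cubicPoly, FreeAlgebra.ι_comp_lift] at k

end Completeness

end StarPI

theorem mainTheorem2 {F : Type*} [Field F] [CharZero F] :
    (∀ g ∈ StarPI.generators F, StarPI.IsStarIdentity (StarPI.M12 F) g) ∧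
    (∀ f : StarPI.FreeStar F, StarPI.IsStarIdentity (StarPI.M12 F) f →
      f ∈ StarPI.degreeLE F 3 → f ∈ StarPI.tIdealSpan (StarPI.generators F)) ∧
    (∀ f : StarPI.FreeStar F, StarPI.IsStarIdentity (StarPI.M12 F) f →
      f ∈ StarPI.degreeLE F 1 → f = 0) := by
  refine ⟨fun g hg => StarPI.isStarIdentity_of_mem_generators hg, fun f hf hd => ?_,
    fun f hf hd => ?_⟩
  · obtain ⟨c₀, c₁, c₂, c₃, rfl⟩ := StarPI.exists_eq_cubicPoly hd
    exact StarPI.toRelFree_eq_zero.1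
      (StarPI.toRelFree_cubicPoly (StarPI.cubicPoly_eq_zero_of_isStarIdentity hf))
  · obtain ⟨c₀, c₁, rfl⟩ := StarPI.exists_eq_linear hd
    obtain ⟨rfl, rfl⟩ :=
      StarPI.linear_eq_zero (StarPI.cubicPoly_eq_zero_of_isStarIdentity hf)
    simp [StarPI.cubicPoly, StarPI.quadratic, StarPI.cubic]
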